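/- For $r>0$, $\gamma>0$, $\mu>0$ let $\overline G_{r,\gamma,\mu}$ denote a random variable with the generalized gamma density $$g^*(x;r,\gamma,\mu)=\frac{\gamma\mu^r}{\Gamma(r)}\,x^{\gamma r-1}e^{-\mu x^{\gamma}},\qquad x\ge 0,$$ and, for $\alpha>0$, let $W_\alpha$ denote a random variable with the Weibull density $g^*(x;1,\alpha,1)=\alpha x^{\alpha-1}e^{-x^\alpha}$, $x\ge0$. For $r,\alpha,\gamma,\lambda>0$ let $$F(x;r,\alpha,\gamma,\lambda)=\mathbb P\Big(\frac{\overline G_{r,\alpha\gamma,\lambda}}{W_\alpha}<x\Big),\qquad x\in\mathbb R,$$ where $\overline G_{r,\alpha\gamma,\lambda}$ and $W_\alpha$ are independent. Theorem. Let $\alpha>0$, $\gamma>0$, $r\in(0,1]$, $\alpha\gamma\in(0,1]$ and $\lambda>0$. Then the distribution function $F(x;r,\alpha,\gamma,\lambda)$ is infinitely divisible, that is, for every integer $n\ge1$ it is the distribution function of a sum of $n$ independent identically distributed real random variables. -/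

import Mathlib

open MeasureTheory

noncomputable section

/-- The density `g*(x; r, γ, μ) = |γ| μ^r / Γ(r) * x^(γ r - 1) * exp (-μ x^γ)`, `x ≥ 0`, of the
generalized gamma distribution, extended by `0` to negative `x`. -/
def genGammaPDF (r γ μ x : ℝ) : ℝ :=
  if 0 ≤ x then
    |γ| * μ ^ r / Real.Gamma r * x ^ (γ * r - 1) * Real.exp (-(μ * x ^ γ))
  else 0

/-- The generalized gamma distribution with parameters `r`, `γ`, `μ`. -/
def genGammaMeasure (r γ μ : ℝ) : Measure ℝ :=
  volume.withDensity fun x => ENNReal.ofReal (genGammaPDF r γ μ x)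

/-- The Weibull distribution with parameter `α`: the generalized gamma distribution with
parameters `1`, `α`, `1`. -/
def weibullMeasure (α : ℝ) : Measure ℝ :=
  genGammaMeasure 1 α 1

/-- The law of the ratio `G / W` of independent random variables, `G` generalized gamma
distributed with parameters `r`, `α * γ`, `μ` and `W` Weibull distributed with parameter `α`. -/
def ratioLaw (r α γ μ : ℝ) : Measure ℝ :=
  ((genGammaMeasure r (α * γ) μ).prod (weibullMeasure α)).map fun p => p.1 / p.2

/-- The distribution function `x ↦ P(X < x)` of a random variable with law `ν`
(the left-continuous convention). -/
def distFun (ν : Measure ℝ) (x : ℝ) : ℝ :=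
  ν.real (Set.Iio x)

/-- The distribution function `F(x; r, α, γ, μ) = P(G / W < x)`. -/
def limitDF (r α γ μ x : ℝ) : ℝ :=
  distFun (ratioLaw r α γ μ) x

/-- A function `F` is an infinitely divisible distribution function: for every `n ≥ 1` it is the
distribution function of the sum of `n` independent random variables with a common law `ν`. -/
def IsInfinitelyDivisibleDF (F : ℝ → ℝ) : Prop :=
  ∀ n : ℕ, 1 ≤ n → ∃ ν : Measure ℝ, IsProbabilityMeasure ν ∧
    F = distFun ((Measure.pi fun _ : Fin n => ν).map fun y => ∑ i, y i)

end

/-! For αγ ≤ 1 and αγr ≤ 1 the density of G is log-convex on (0, ∞). By Cauchy–Schwarz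
(`sq_lintegral_le_of_sq_le`) its masses on consecutive cells of any lattice form a log-convex
sequence. Given W = w, the ratio only rescales the lattice, and a second Cauchy–Schwarz shows that
mixing over w keeps log-convexity; of W only positivity matters. Rounding G/W down to a lattice thus
gives log-convex weights. Their generating series P has P'/P with nonnegative coefficients
(`exists_logDeriv_nonneg`), so P^(1/m) = exp((log P)/m) also has nonnegative coefficients and is the
generating function of a convolution root. As the mesh shrinks, tightness gives a limit of the roots
(`exists_root_of_tendsto`). -/

namespace PowerSeries

/-! ### Roots of power series with log-convex coefficients -/

theorem coeff_succ_of_derivative_eq_mul {R A : PowerSeries ℝ} (h : derivative ℝ A = R * A) (n : ℕ) :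
    coeff (n + 1) A * (n + 1) =
      ∑ x ∈ Finset.HasAntidiagonal.antidiagonal n, coeff x.1 R * coeff x.2 A := by
  rw [← coeff_mul, ← h, coeff_derivative]

theorem eq_of_derivative_eq_mul {R A B : PowerSeries ℝ} (hA : derivative ℝ A = R * A)
    (hB : derivative ℝ B = R * B) (h0 : coeff 0 A = coeff 0 B) : A = B := by
  ext n
  induction n using Nat.strong_induction_on with
  | _ n ih =>
    cases n with
    | zero => exact h0
    | succ n =>
      have hn : (n : ℝ) + 1 ≠ 0 := by positivity
      apply mul_right_cancel₀ hn
      rw [coeff_succ_of_derivative_eq_mul hA, coeff_succ_of_derivative_eq_mul hB]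
      refine Finset.sum_congr rfl fun x hx => ?_
      rw [ih x.2 (by have := Finset.HasAntidiagonal.mem_antidiagonal.mp hx; omega)]

/-- Coefficients of the solution of `Q' = R Q` with `Q(0) = c`. -/
noncomputable def linearODECoeff (R : PowerSeries ℝ) (c : ℝ) : ℕ → ℝ
  | 0 => c
  | n + 1 => (∑ k : Fin (n + 1), coeff (n - k) R * linearODECoeff R c k) / (n + 1)

theorem linearODECoeff_nonneg {R : PowerSeries ℝ} {c : ℝ} (hR : ∀ n, 0 ≤ coeff n R) (hc : 0 ≤ c)
    (n : ℕ) : 0 ≤ linearODECoeff R c n := by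
  induction n using Nat.strong_induction_on with
  | _ n ih =>
    cases n with
    | zero => simpa [linearODECoeff] using hc
    | succ n =>
      rw [linearODECoeff]
      exact div_nonneg (Finset.sum_nonneg fun k _ => mul_nonneg (hR _) (ih k k.2)) (by positivity)

theorem exists_derivative_eq_mul {R : PowerSeries ℝ} {c : ℝ} (hR : ∀ n, 0 ≤ coeff n R)
    (hc : 0 ≤ c) :
    ∃ Q : PowerSeries ℝ, coeff 0 Q = c ∧ derivative ℝ Q = R * Q ∧ ∀ n, 0 ≤ coeff n Q := by
  refine ⟨mk (linearODECoeff R c), by simp [linearODECoeff], ?_, fun n => ?_⟩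
  · ext n
    rw [coeff_derivative, mul_comm R, coeff_mul,
      Finset.Nat.sum_antidiagonal_eq_sum_range_succ_mk, Finset.sum_range]
    have hn : (n : ℝ) + 1 ≠ 0 := by positivity
    simp only [coeff_mk]
    rw [linearODECoeff, div_mul_cancel₀ _ hn]
    exact Finset.sum_congr rfl fun k _ => mul_comm _ _
  · rw [coeff_mk]
    exact linearODECoeff_nonneg hR hc n

/-- The logarithmic derivative of a power series with positive log-convex coefficients has
nonnegative coefficients. -/
theorem exists_logDeriv_nonneg {P : PowerSeries ℝ} (hpos : ∀ n, 0 < coeff n P)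
    (hlc : ∀ n, coeff (n + 1) P ^ 2 ≤ coeff n P * coeff (n + 2) P) :
    ∃ R : PowerSeries ℝ, derivative ℝ P = R * P ∧ ∀ n, 0 ≤ coeff n R := by
  have h0 : constantCoeff P ≠ 0 := by
    rw [← coeff_zero_eq_constantCoeff_apply]; exact (hpos 0).ne'
  have hR : derivative ℝ P = (derivative ℝ P * P⁻¹) * P := by
    rw [mul_assoc, PowerSeries.inv_mul_cancel _ h0, mul_one]
  refine ⟨derivative ℝ P * P⁻¹, hR, ?_⟩
  generalize derivative ℝ P * P⁻¹ = R at hR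
  have hratio : Monotone fun n => coeff (n + 1) P / coeff n P := by
    refine monotone_nat_of_le_succ fun n => ?_
    rw [div_le_div_iff₀ (hpos _) (hpos _)]
    nlinarith [hlc n]
  have hrec := coeff_succ_of_derivative_eq_mul hR
  simp only [Finset.Nat.sum_antidiagonal_eq_sum_range_succ_mk] at hrec
  intro n
  induction n using Nat.strong_induction_on with
  | _ n ih =>
    have hn := hrec n
    rw [Finset.sum_range_succ, Nat.sub_self] at hn
    -- With p, r the coefficients of P, R, it remains to bound the terms k < n of the recursion. For
    -- n = j + 1, monotone ratios give p_{j+1-k} ≤ (p_{j+1}/p_j) p_{j-k}, and the recursion at j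
    -- sums the right-hand sides.
    have key : ∑ k ∈ Finset.range n, coeff k R * coeff (n - k) P ≤
        coeff (n + 1) P * (n + 1) := by
      cases n with
      | zero => simpa using (hpos 1).le
      | succ j =>
        calc ∑ k ∈ Finset.range (j + 1), coeff k R * coeff (j + 1 - k) P
            ≤ ∑ k ∈ Finset.range (j + 1),
              coeff (j + 1) P / coeff j P * (coeff k R * coeff (j - k) P) := by
              refine Finset.sum_le_sum fun k hk => ?_
              have hk' : k ≤ j := by simpa [Nat.lt_succ_iff] using hk
              have h1 := hratio (Nat.sub_le j k)
              simp only at h1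
              rw [div_le_iff₀ (hpos _), show j - k + 1 = j + 1 - k by omega] at h1
              nlinarith [mul_le_mul_of_nonneg_left h1 (ih k (by omega))]
          _ = coeff (j + 1) P / coeff j P * (coeff (j + 1) P * (j + 1)) := by
              rw [← Finset.mul_sum, ← hrec j]
          _ ≤ coeff (j + 2) P * (j + 1) := by
              rw [div_mul_eq_mul_div, div_le_iff₀ (hpos _)]
              have := mul_le_mul_of_nonneg_right (hlc j) (show (0 : ℝ) ≤ j + 1 by positivity)
              nlinarith
          _ ≤ coeff (j + 1 + 1) P * ((j + 1 : ℕ) + 1) := by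
              push_cast
              have := (hpos (j + 2)).le
              gcongr
              linarith
    have : 0 ≤ coeff n R * coeff 0 P := by linarith
    exact nonneg_of_mul_nonneg_left this (hpos 0)

/-- A power series with positive log-convex coefficients has roots of all orders with nonnegative
coefficients. -/
theorem exists_pow_eq_of_logConvex {P : PowerSeries ℝ} (hpos : ∀ n, 0 < coeff n P)
    (hlc : ∀ n, coeff (n + 1) P ^ 2 ≤ coeff n P * coeff (n + 2) P) {m : ℕ} (hm : m ≠ 0) :
    ∃ Q : PowerSeries ℝ, Q ^ m = P ∧ ∀ n, 0 ≤ coeff n Q := by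
  obtain ⟨R, hR, hR0⟩ := exists_logDeriv_nonneg hpos hlc
  have hm' : (m : ℝ) ≠ 0 := by exact_mod_cast hm
  -- Solving Q' = (R/m)Q makes Q^m a solution of the equation for P with the same constant term.
  obtain ⟨Q, hQ0, hQ, hQn⟩ := exists_derivative_eq_mul (R := C (m : ℝ)⁻¹ * R)
    (c := coeff 0 P ^ (m : ℝ)⁻¹)
    (fun n => by rw [coeff_C_mul]; exact mul_nonneg (by positivity) (hR0 n))
    (Real.rpow_nonneg (hpos 0).le _)
  refine ⟨Q, eq_of_derivative_eq_mul (R := R) ?_ hR ?_, hQn⟩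
  · rw [Derivation.leibniz_pow, hQ]
    obtain ⟨j, rfl⟩ := Nat.exists_eq_succ_of_ne_zero hm
    have hC : ((j + 1 : ℕ) : PowerSeries ℝ) * C ((j + 1 : ℕ) : ℝ)⁻¹ = 1 := by
      rw [← map_natCast (C (R := ℝ)), ← map_mul, mul_inv_cancel₀ hm', map_one]
    simp only [Nat.succ_eq_add_one, Nat.add_sub_cancel, smul_eq_mul, nsmul_eq_mul]
    calc ((j + 1 : ℕ) : PowerSeries ℝ) * (Q ^ j * (C ((j + 1 : ℕ) : ℝ)⁻¹ * R * Q))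
        = (((j + 1 : ℕ) : PowerSeries ℝ) * C ((j + 1 : ℕ) : ℝ)⁻¹) * (R * Q ^ (j + 1)) := by ring
      _ = R * Q ^ (j + 1) := by rw [hC, one_mul]
  · rw [coeff_zero_eq_constantCoeff_apply, map_pow, ← coeff_zero_eq_constantCoeff_apply, hQ0,
      Real.rpow_inv_natCast_pow (hpos 0).le hm]

/-- Absolute convergence on the unit circle lets Cauchy products turn the formal power into a power
of values. -/
theorem summable_coeff_pow_and_tsum {Q : PowerSeries ℝ} (hQ : ∀ n, 0 ≤ coeff n Q)
    (hs : Summable fun n => coeff n Q) {z : ℂ} (hz : ‖z‖ = 1) (m : ℕ) :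
    (∀ n, 0 ≤ coeff n (Q ^ m)) ∧ Summable (fun n => coeff n (Q ^ m)) ∧
      ∑' n, ((coeff n (Q ^ m) : ℝ) : ℂ) * z ^ n = (∑' n, ((coeff n Q : ℝ) : ℂ) * z ^ n) ^ m := by
  have hnorm : ∀ {A : PowerSeries ℝ}, (∀ n, 0 ≤ coeff n A) →
      (fun n => ‖((coeff n A : ℝ) : ℂ) * z ^ n‖) = fun n => coeff n A := by
    intro A hA
    ext n
    rw [norm_mul, norm_pow, hz, one_pow, mul_one, Complex.norm_real, Real.norm_of_nonneg (hA n)]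
  induction m with
  | zero =>
    refine ⟨fun n => ?_, ?_, ?_⟩
    · rw [pow_zero, coeff_one]; split_ifs <;> norm_num
    · simp only [pow_zero, coeff_one]
      exact (hasSum_ite_eq 0 (1 : ℝ)).summable
    · rw [pow_zero, pow_zero, tsum_eq_single 0]
      · simp
      · intro n hn
        simp [coeff_one, hn]
  | succ m ih =>
    obtain ⟨h1, h2, h3⟩ := ih
    have s1 := h2
    have s2 := hs
    rw [← hnorm h1] at s1
    rw [← hnorm hQ] at s2
    have hn : ∀ n, 0 ≤ coeff n (Q ^ (m + 1)) := fun n => by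
      rw [pow_succ, coeff_mul]
      exact Finset.sum_nonneg fun x _ => mul_nonneg (h1 _) (hQ _)
    have hc : ∀ n, ∑ kl ∈ Finset.HasAntidiagonal.antidiagonal n,
        (((coeff kl.1 (Q ^ m) : ℝ) : ℂ) * z ^ kl.1) * (((coeff kl.2 Q : ℝ) : ℂ) * z ^ kl.2) =
        ((coeff n (Q ^ (m + 1)) : ℝ) : ℂ) * z ^ n := fun n => by
      rw [pow_succ, coeff_mul]
      push_cast
      rw [Finset.sum_mul]
      refine Finset.sum_congr rfl fun x hx => ?_
      rw [← Finset.HasAntidiagonal.mem_antidiagonal.mp hx, pow_add]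
      ring
    refine ⟨hn, ?_, ?_⟩
    · have := summable_norm_sum_mul_antidiagonal_of_summable_norm s1 s2
      simp only [hc] at this
      rwa [hnorm hn] at this
    · rw [pow_succ (∑' n, _), ← h3, tsum_mul_tsum_eq_tsum_sum_antidiagonal_of_summable_norm s1 s2]
      simp only [hc]

/-- A single term of a convolution of nonnegative sequences; it transfers summability from a power
of Q back to Q. -/
theorem pow_mul_coeff_le_coeff_pow {Q : PowerSeries ℝ} (hQ : ∀ n, 0 ≤ coeff n Q) (m n : ℕ) :
    coeff 0 Q ^ m * coeff n Q ≤ coeff n (Q ^ (m + 1)) := by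
  induction m with
  | zero => simp
  | succ m ih =>
    have hnn : ∀ m n, 0 ≤ coeff n (Q ^ m) := by
      intro m
      induction m with
      | zero => intro n; rw [pow_zero, coeff_one]; split_ifs <;> norm_num
      | succ m ih =>
        intro n
        rw [pow_succ, coeff_mul]
        exact Finset.sum_nonneg fun x _ => mul_nonneg (ih _) (hQ _)
    rw [pow_succ' Q (m + 1), coeff_mul]
    calc coeff 0 Q ^ (m + 1) * coeff n Q = coeff 0 Q * (coeff 0 Q ^ m * coeff n Q) := by ring
      _ ≤ coeff 0 Q * coeff n (Q ^ (m + 1)) := mul_le_mul_of_nonneg_left ih (hQ 0)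
      _ ≤ ∑ x ∈ Finset.HasAntidiagonal.antidiagonal n,
          coeff x.1 Q * coeff x.2 (Q ^ (m + 1)) := by
        have h0 : ((0, n) : ℕ × ℕ) ∈ Finset.HasAntidiagonal.antidiagonal n := by simp
        exact Finset.single_le_sum
          (f := fun x : ℕ × ℕ => coeff x.1 Q * coeff x.2 (Q ^ (m + 1)))
          (fun x _ => mul_nonneg (hQ _) (hnn _ _)) h0

end PowerSeries

/-! ### Convolution roots on ℕ -/

theorem integral_pow_eq_tsum {ρ : Measure ℕ} [IsFiniteMeasure ρ] {z : ℂ} (hz : ‖z‖ = 1) :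
    ∫ k, z ^ k ∂ρ = ∑' k, (ρ.real {k} : ℂ) * z ^ k := by
  rw [integral_countable]
  · simp
  · refine Integrable.of_bound (C := 1) (by fun_prop) (Filter.Eventually.of_forall fun k => ?_)
    simp [hz]

/-- A probability measure on `ℕ` with positive log-convex weights has convolution roots of all
orders. -/
theorem exists_measure_nat_root {ρ : Measure ℕ} [IsProbabilityMeasure ρ]
    (hpos : ∀ k, 0 < ρ.real {k}) (hlc : ∀ k, ρ.real {k + 1} ^ 2 ≤ ρ.real {k} * ρ.real {k + 2})
    {m : ℕ} (hm : m ≠ 0) :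
    ∃ σ : Measure ℕ, IsProbabilityMeasure σ ∧
      ∀ z : ℂ, ‖z‖ = 1 → (∫ k, z ^ k ∂σ) ^ m = ∫ k, z ^ k ∂ρ := by
  obtain ⟨Q, hQ, hQ0⟩ := PowerSeries.exists_pow_eq_of_logConvex
    (P := PowerSeries.mk fun k => ρ.real {k}) (by simpa using hpos) (by simpa using hlc) hm
  have hρ : Summable fun k => ρ.real {k} := by
    have := (hasSum_integral_measure (μ := fun k => ρ {k} • Measure.dirac k)
      (f := fun _ : ℕ => (1 : ℝ)) (by rw [Measure.sum_smul_dirac]; exact integrable_const _)).summable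
    simpa [integral_smul_measure, measureReal_def] using this
  have hcoeff : ∀ k, PowerSeries.coeff k (Q ^ m) = ρ.real {k} := by simp [hQ]
  obtain ⟨j, rfl⟩ := Nat.exists_eq_succ_of_ne_zero hm
  have hq0 : 0 < PowerSeries.coeff 0 Q := by
    refine lt_of_le_of_ne (hQ0 0) fun h => ?_
    have h1 := hcoeff 0
    rw [PowerSeries.coeff_zero_eq_constantCoeff_apply, map_pow,
      ← PowerSeries.coeff_zero_eq_constantCoeff_apply, ← h, zero_pow hm] at h1
    exact (hpos 0).ne h1
  have hs : Summable fun k => PowerSeries.coeff k Q := by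
    refine Summable.of_nonneg_of_le hQ0 (fun k => ?_)
      (hρ.mul_left ((PowerSeries.coeff 0 Q ^ j)⁻¹))
    rw [← hcoeff, inv_mul_eq_div, le_div_iff₀ (by positivity), mul_comm]
    exact PowerSeries.pow_mul_coeff_le_coeff_pow hQ0 j k
  let σ : Measure ℕ := Measure.sum fun k => ENNReal.ofReal (PowerSeries.coeff k Q) • Measure.dirac k
  have hσ : ∀ k, σ {k} = ENNReal.ofReal (PowerSeries.coeff k Q) := fun k => by
    simp only [σ]
    rw [Measure.sum_apply _ (MeasurableSet.singleton k), tsum_eq_single k]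
    · simp
    · intro i hi
      simp [hi]
  have : IsFiniteMeasure σ := ⟨by
    simp only [σ]
    rw [Measure.sum_apply _ MeasurableSet.univ]
    simp only [Measure.smul_apply, measure_univ, smul_eq_mul, mul_one]
    rw [← ENNReal.ofReal_tsum_of_nonneg hQ0 hs]
    exact ENNReal.ofReal_lt_top⟩
  have key : ∀ z : ℂ, ‖z‖ = 1 → (∫ k, z ^ k ∂σ) ^ (j + 1) = ∫ k, z ^ k ∂ρ := by
    intro z hz
    rw [integral_pow_eq_tsum hz, integral_pow_eq_tsum hz]
    simp only [measureReal_def σ, hσ, ENNReal.toReal_ofReal (hQ0 _)]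
    rw [← (PowerSeries.summable_coeff_pow_and_tsum hQ0 hs hz (j + 1)).2.2]
    simp [hcoeff]
  refine ⟨σ, ?_, key⟩
  -- At z = 1 the root identity says that the total mass has power 1.
  have h1 := key 1 (by simp)
  simp only [one_pow, integral_const, probReal_univ, one_smul] at h1
  rw [Complex.real_smul, mul_one] at h1
  have h2 : σ.real Set.univ ^ (j + 1) = 1 := by exact_mod_cast h1
  have h3 : σ.real Set.univ = 1 := (pow_eq_one_iff_of_nonneg measureReal_nonneg hm).mp h2
  exact ⟨by rwa [measureReal_def, ENNReal.toReal_eq_one_iff] at h3⟩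

/-! ### From lattices to the half-line -/

open Filter Topology in
/-- A probability measure which is the limit of `n`-th convolution powers of probability measures
on `[0, ∞)` is an `n`-th convolution power. -/
theorem exists_root_of_tendsto {n : ℕ} (hn : 1 ≤ n) {μ : ProbabilityMeasure ℝ}
    {μs νs : ℕ → ProbabilityMeasure ℝ} (hlim : Tendsto μs atTop (𝓝 μ))
    (hnonneg : ∀ j, ∀ᵐ x ∂(νs j : Measure ℝ), 0 ≤ x)
    (hroot : ∀ j, (Measure.pi fun _ : Fin n => (νs j : Measure ℝ)).map (fun y => ∑ i, y i) = μs j) :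
    ∃ ν : ProbabilityMeasure ℝ,
      (Measure.pi fun _ : Fin n => (ν : Measure ℝ)).map (fun y => ∑ i, y i) = μ := by
  have hmeas : Measurable fun y : Fin n → ℝ => ∑ i, y i := by fun_prop
  have hchar : ∀ (ν : ProbabilityMeasure ℝ) (t : ℝ),
      charFun ((Measure.pi fun _ : Fin n => (ν : Measure ℝ)).map fun y => ∑ i, y i) t =
        charFun (ν : Measure ℝ) t ^ n := fun ν t => by
    rw [ProbabilityTheory.charFun_map_sum_pi_eq_prod, Finset.prod_apply, Finset.prod_const, Finset.card_univ,
      Fintype.card_fin]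
  -- Nonnegative summands are bounded by their sum, so the tails of the roots inherit tightness from
  -- those of the powers.
  have hdom : ∀ j (r : ℝ), (νs j : Measure ℝ) {x | r < ‖x‖} ≤ (μs j : Measure ℝ) {x | r < ‖x‖} := by
    intro j r
    have hmp := measurePreserving_eval (fun _ : Fin n => (νs j : Measure ℝ)) ⟨0, hn⟩
    have hset : MeasurableSet {x : ℝ | r < ‖x‖} := measurableSet_lt measurable_const measurable_norm
    rw [← hroot j, Measure.map_apply hmeas hset, ← hmp.measure_preimage hset.nullMeasurableSet]
    refine measure_mono_ae ?_
    have hall : ∀ᵐ y ∂(Measure.pi fun _ : Fin n => (νs j : Measure ℝ)), ∀ i, 0 ≤ y i :=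
      ae_all_iff.mpr fun i =>
        (measurePreserving_eval (fun _ : Fin n => (νs j : Measure ℝ)) i).quasiMeasurePreserving.ae
          (hnonneg j)
    filter_upwards [hall] with y hy hyr
    have h1 : r < ‖y ⟨0, hn⟩‖ := hyr
    have h2 : y ⟨0, hn⟩ ≤ ∑ i, y i :=
      Finset.single_le_sum (f := y) (fun i _ => hy i) (Finset.mem_univ _)
    change r < ‖∑ i, y i‖
    rw [Real.norm_of_nonneg (hy _)] at h1
    rw [Real.norm_of_nonneg (Finset.sum_nonneg fun i _ => hy i)]
    exact h1.trans_le h2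
  have htμ : IsTightMeasureSet (Set.range fun j => (μs j : Measure ℝ)) :=
    isTightMeasureSet_of_tendsto_charFun (f := charFun (μ : Measure ℝ)) (by fun_prop)
      (ProbabilityMeasure.tendsto_iff_tendsto_charFun.mp hlim)
  have htν : IsTightMeasureSet (Set.range fun j => (νs j : Measure ℝ)) := by
    rw [isTightMeasureSet_iff_tendsto_measure_norm_gt] at htμ ⊢
    refine tendsto_of_tendsto_of_tendsto_of_le_of_le tendsto_const_nhds htμ (fun _ => zero_le) ?_
    intro r
    simp only [iSup_range]
    exact iSup_mono fun j => hdom j r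
  have hcompact : IsCompact (closure (Set.range νs)) :=
    isCompact_closure_of_isTightMeasureSet (by
      convert htν using 1
      ext x
      simp)
  obtain ⟨ν, -, φ, hφ, hν⟩ := hcompact.tendsto_subseq fun j => subset_closure ⟨j, rfl⟩
  refine ⟨ν, ?_⟩
  have : IsProbabilityMeasure
      ((Measure.pi fun _ : Fin n => (ν : Measure ℝ)).map fun y => ∑ i, y i) :=
    Measure.isProbabilityMeasure_map hmeas.aemeasurable
  refine Measure.ext_of_charFun (funext fun t => ?_)
  rw [hchar]
  have h1 := (ProbabilityMeasure.tendsto_iff_tendsto_charFun.mp hν t).pow n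
  have h2 := (ProbabilityMeasure.tendsto_iff_tendsto_charFun.mp hlim t).comp hφ.tendsto_atTop
  refine tendsto_nhds_unique h1 (h2.congr fun j => ?_)
  simp only [Function.comp_apply]
  rw [← hroot, hchar]

/-- A probability measure on the lattice `h ℕ` with positive log-convex weights has convolution
roots of all orders, again on the lattice. -/
theorem exists_lattice_root {ρ : Measure ℕ} [IsProbabilityMeasure ρ]
    (hpos : ∀ k, 0 < ρ.real {k}) (hlc : ∀ k, ρ.real {k + 1} ^ 2 ≤ ρ.real {k} * ρ.real {k + 2})
    {n : ℕ} (hn : 1 ≤ n) {h : ℝ} (hh : 0 ≤ h) :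
    ∃ ν : ProbabilityMeasure ℝ, (∀ᵐ x ∂(ν : Measure ℝ), 0 ≤ x) ∧
      (Measure.pi fun _ : Fin n => (ν : Measure ℝ)).map (fun y => ∑ i, y i) =
        ρ.map fun k : ℕ => h * (k : ℝ) := by
  obtain ⟨σ, hσ, hroot⟩ := exists_measure_nat_root hpos hlc (m := n) (by omega)
  have hmeas : Measurable fun k : ℕ => h * (k : ℝ) := by fun_prop
  have hchar : ∀ τ : Measure ℕ, ∀ t : ℝ, charFun (τ.map fun k : ℕ => h * (k : ℝ)) t =
      ∫ k, Complex.exp (t * h * Complex.I) ^ k ∂τ := by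
    intro τ t
    rw [charFun_apply_real, integral_map hmeas.aemeasurable (by fun_prop)]
    refine integral_congr_ae (Filter.Eventually.of_forall fun k => ?_)
    simp only
    rw [← Complex.exp_nat_mul]
    push_cast
    ring_nf
  have hp : IsProbabilityMeasure (σ.map fun k : ℕ => h * (k : ℝ)) :=
    Measure.isProbabilityMeasure_map hmeas.aemeasurable
  have hp' : IsProbabilityMeasure (ρ.map fun k : ℕ => h * (k : ℝ)) :=
    Measure.isProbabilityMeasure_map hmeas.aemeasurable
  refine ⟨⟨_, hp⟩, ?_, ?_⟩
  · rw [ProbabilityMeasure.coe_mk,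
      ae_map_iff hmeas.aemeasurable measurableSet_Ici]
    exact Filter.Eventually.of_forall fun k => by positivity
  · rw [ProbabilityMeasure.coe_mk]
    have : IsProbabilityMeasure
        ((Measure.pi fun _ : Fin n => σ.map fun k : ℕ => h * (k : ℝ)).map fun y => ∑ i, y i) :=
      Measure.isProbabilityMeasure_map (by fun_prop)
    refine Measure.ext_of_charFun (funext fun t => ?_)
    rw [ProbabilityTheory.charFun_map_sum_pi_eq_prod, Finset.prod_apply, Finset.prod_const, Finset.card_univ,
      Fintype.card_fin, hchar, hchar]
    refine hroot _ ?_
    rw [← Complex.ofReal_mul, Complex.norm_exp_ofReal_mul_I]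

open Filter Topology in
theorem tendsto_mul_floor_div {x : ℝ} (hx : 0 ≤ x) :
    Tendsto (fun j : ℕ => 1 / ((j : ℝ) + 1) * (⌊x / (1 / ((j : ℝ) + 1))⌋₊ : ℝ)) atTop (𝓝 x) := by
  have h0 : Tendsto (fun j : ℕ => x - 1 / ((j : ℝ) + 1)) atTop (𝓝 x) := by
    simpa using tendsto_const_nhds.sub (tendsto_one_div_add_atTop_nhds_zero_nat (𝕜 := ℝ))
  refine tendsto_of_tendsto_of_tendsto_of_le_of_le h0 tendsto_const_nhds (fun j => ?_) fun j => ?_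
  · have hj : 0 < 1 / ((j : ℝ) + 1) := by positivity
    have h1 := (Nat.lt_floor_add_one (x / (1 / ((j : ℝ) + 1)))).le
    rw [div_le_iff₀ hj] at h1
    simp only
    linarith
  · have hj : 0 < 1 / ((j : ℝ) + 1) := by positivity
    have h1 := Nat.floor_le (show 0 ≤ x / (1 / ((j : ℝ) + 1)) by positivity)
    rw [le_div_iff₀ hj] at h1
    simp only
    linarith

open Filter Topology in
/-- A probability measure on `[0, ∞)` whose masses on the cells of every lattice are positive and
log-convex has convolution roots of all orders. -/
theorem exists_root_of_logConvex_cells {μ : Measure ℝ} [IsProbabilityMeasure μ]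
    (hnonneg : ∀ᵐ x ∂μ, 0 ≤ x)
    (hpos : ∀ h : ℝ, 0 < h → ∀ k : ℕ, 0 < μ (Set.Ico (h * k) (h * (k + 1))))
    (hlc : ∀ h : ℝ, 0 < h → ∀ k : ℕ, μ (Set.Ico (h * (k + 1)) (h * (k + 2))) ^ 2 ≤
      μ (Set.Ico (h * k) (h * (k + 1))) * μ (Set.Ico (h * (k + 2)) (h * (k + 3))))
    {n : ℕ} (hn : 1 ≤ n) :
    ∃ ν : Measure ℝ, IsProbabilityMeasure ν ∧
      (Measure.pi fun _ : Fin n => ν).map (fun y => ∑ i, y i) = μ := by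
  have hfl : ∀ h : ℝ, Measurable fun x : ℝ => ⌊x / h⌋₊ := fun h =>
    Nat.measurable_floor.comp (measurable_id.div_const h)
  have hcell : ∀ h : ℝ, 0 < h → ∀ k : ℕ,
      (μ.map fun x => ⌊x / h⌋₊) {k} = μ (Set.Ico (h * k) (h * (k + 1))) := by
    intro h hh k
    rw [Measure.map_apply (hfl h) (MeasurableSet.singleton k)]
    -- Equality holds only almost everywhere: `⌊x / h⌋₊` is also 0 for negative x.
    refine measure_congr ?_
    filter_upwards [hnonneg] with x hx
    have h1 : ⌊x / h⌋₊ = k ↔ h * k ≤ x ∧ x < h * (k + 1) := by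
      rw [Nat.floor_eq_iff (by positivity), le_div_iff₀ hh, div_lt_iff₀ hh, mul_comm h, mul_comm h]
    exact propext h1
  have hlat : ∀ h : ℝ, 0 < h → ∃ ν : ProbabilityMeasure ℝ, (∀ᵐ x ∂(ν : Measure ℝ), 0 ≤ x) ∧
      (Measure.pi fun _ : Fin n => (ν : Measure ℝ)).map (fun y => ∑ i, y i) =
        μ.map fun x => h * (⌊x / h⌋₊ : ℝ) := by
    intro h hh
    have : IsProbabilityMeasure (μ.map fun x => ⌊x / h⌋₊) :=
      Measure.isProbabilityMeasure_map (hfl h).aemeasurable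
    obtain ⟨ν, hν, hroot⟩ := exists_lattice_root (ρ := μ.map fun x => ⌊x / h⌋₊) (fun k => by
        rw [measureReal_def, hcell h hh]
        exact ENNReal.toReal_pos (hpos h hh k).ne' (measure_ne_top _ _)) (fun k => by
        simp only [measureReal_def, hcell h hh]
        rw [← ENNReal.toReal_pow, ← ENNReal.toReal_mul]
        refine ENNReal.toReal_mono (ENNReal.mul_ne_top (measure_ne_top _ _) (measure_ne_top _ _)) ?_
        convert! hlc h hh k using 4 <;> push_cast <;> ring) hn hh.le
    refine ⟨ν, hν, ?_⟩
    rw [hroot, Measure.map_map (measurable_from_nat (f := fun k : ℕ => h * (k : ℝ))) (hfl h)]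
    rfl
  choose! ν hν hroot using hlat
  have hX : ∀ h : ℝ, Measurable fun x : ℝ => h * (⌊x / h⌋₊ : ℝ) := fun h =>
    ((measurable_from_nat (f := fun k : ℕ => (k : ℝ))).comp (hfl h)).const_mul h
  have hdist : TendstoInDistribution
      (fun (j : ℕ) (x : ℝ) => 1 / ((j : ℝ) + 1) * (⌊x / (1 / ((j : ℝ) + 1))⌋₊ : ℝ)) atTop id
      (fun _ => μ) μ := by
    refine tendstoInDistribution_of_ae_tendsto (fun j => (hX _).aemeasurable) ?_ ?_
    · exact aemeasurable_id
    · filter_upwards [hnonneg] with x hx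
      exact tendsto_mul_floor_div hx
  obtain ⟨ν', hν'⟩ := exists_root_of_tendsto hn (νs := fun j : ℕ => ν (1 / ((j : ℝ) + 1)))
    hdist.tendsto (fun j => hν _ (by positivity)) (fun j => by
      rw [hroot _ (by positivity)]; rfl)
  refine ⟨ν', inferInstance, hν'.trans ?_⟩
  simp

/-! ### Cauchy–Schwarz and the generalized gamma law -/

theorem sq_lintegral_le_of_sq_le {Ω : Type*} [MeasurableSpace Ω] {μ : Measure Ω}
    {a b c : Ω → ENNReal} (hb : AEMeasurable b μ) (hc : AEMeasurable c μ)
    (h : ∀ᵐ x ∂μ, a x ^ 2 ≤ b x * c x) :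
    (∫⁻ x, a x ∂μ) ^ 2 ≤ (∫⁻ x, b x ∂μ) * ∫⁻ x, c x ∂μ := by
  have hsq : ∀ x : ENNReal, (x ^ (1 / 2 : ℝ)) ^ (2 : ℝ) = x := fun x => by
    rw [← ENNReal.rpow_mul]; norm_num
  have h1 : ∫⁻ x, a x ∂μ ≤ ∫⁻ x, b x ^ (1 / 2 : ℝ) * c x ^ (1 / 2 : ℝ) ∂μ := by
    refine lintegral_mono_ae ?_
    filter_upwards [h] with x hx
    rw [← ENNReal.mul_rpow_of_nonneg _ _ (by norm_num : (0 : ℝ) ≤ 1 / 2)]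
    calc a x = (a x ^ 2) ^ (1 / 2 : ℝ) := by
          rw [← ENNReal.rpow_natCast, ← ENNReal.rpow_mul]; norm_num
      _ ≤ _ := ENNReal.rpow_le_rpow hx (by norm_num)
  have h2 := ENNReal.lintegral_mul_le_Lp_mul_Lq μ Real.HolderConjugate.two_two
    (hb.pow_const (1 / 2 : ℝ)) (hc.pow_const (1 / 2 : ℝ))
  simp only [hsq] at h2
  calc (∫⁻ x, a x ∂μ) ^ 2
      ≤ ((∫⁻ x, b x ∂μ) ^ (1 / 2 : ℝ) * (∫⁻ x, c x ∂μ) ^ (1 / 2 : ℝ)) ^ 2 := by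
        gcongr
        exact h1.trans h2
    _ = _ := by
        rw [mul_pow, ← ENNReal.rpow_natCast, ← ENNReal.rpow_natCast, Nat.cast_ofNat, hsq, hsq]

theorem measurable_genGammaPDF (r γ μ : ℝ) : Measurable (genGammaPDF r γ μ) :=
  Measurable.ite measurableSet_Ici (by fun_prop) measurable_const

theorem genGammaPDF_nonneg {r μ : ℝ} (hr : 0 < r) (hμ : 0 < μ) (γ x : ℝ) :
    0 ≤ genGammaPDF r γ μ x := by
  unfold genGammaPDF
  have := Real.Gamma_pos_of_pos hr
  split_ifs with hx <;> positivity

theorem genGammaPDF_pos {r γ μ x : ℝ} (hr : 0 < r) (hγ : 0 < γ) (hμ : 0 < μ) (hx : 0 < x) :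
    0 < genGammaPDF r γ μ x := by
  rw [genGammaPDF, if_pos hx.le]
  have := Real.Gamma_pos_of_pos hr
  positivity

theorem integral_genGammaPDF {r γ μ : ℝ} (hr : 0 < r) (hγ : 0 < γ) (hμ : 0 < μ) :
    ∫ x, genGammaPDF r γ μ x = 1 := by
  have h1 : ∫ x, genGammaPDF r γ μ x = ∫ x in Set.Ioi 0, genGammaPDF r γ μ x := by
    rw [← integral_Ici_eq_integral_Ioi, setIntegral_eq_integral_of_forall_compl_eq_zero]
    intro x hx
    exact if_neg hx
  have h2 : ∀ x ∈ Set.Ioi (0 : ℝ), genGammaPDF r γ μ x =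
      γ * μ ^ r / Real.Gamma r * (x ^ (γ * r - 1) * Real.exp (-μ * x ^ γ)) := by
    intro x hx
    rw [genGammaPDF, if_pos (le_of_lt hx), abs_of_pos hγ, mul_assoc, neg_mul]
  rw [h1, setIntegral_congr_fun measurableSet_Ioi h2, integral_const_mul,
    integral_rpow_mul_exp_neg_mul_rpow hγ (by nlinarith [mul_pos hγ hr]) hμ]
  have hG := (Real.Gamma_pos_of_pos hr).ne'
  rw [show -(γ * r - 1 + 1) / γ = -r by field_simp; ring,
    show (γ * r - 1 + 1) / γ = r by field_simp; ring, Real.rpow_neg hμ.le]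
  have := (Real.rpow_pos_of_pos hμ r).ne'
  field_simp

theorem isProbabilityMeasure_genGammaMeasure {r γ μ : ℝ} (hr : 0 < r) (hγ : 0 < γ) (hμ : 0 < μ) :
    IsProbabilityMeasure (genGammaMeasure r γ μ) := by
  have h1 := integral_genGammaPDF hr hγ hμ
  refine ⟨?_⟩
  rw [genGammaMeasure, withDensity_apply _ MeasurableSet.univ, Measure.restrict_univ,
    ← ofReal_integral_eq_lintegral_ofReal, h1, ENNReal.ofReal_one]
  -- A non-integrable density would have integral 0 by convention, not 1.
  · by_contra h
    rw [integral_undef h] at h1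
    exact zero_ne_one h1
  · exact Filter.Eventually.of_forall (genGammaPDF_nonneg hr hμ γ)

theorem ae_pos_genGammaMeasure (r γ μ : ℝ) : ∀ᵐ x ∂genGammaMeasure r γ μ, 0 < x := by
  rw [genGammaMeasure, ae_withDensity_iff (measurable_genGammaPDF r γ μ).ennreal_ofReal]
  filter_upwards [Measure.ae_ne volume (0 : ℝ)] with x hx h
  by_contra hn
  refine h ?_
  rw [genGammaPDF, if_neg fun h0 => hn (lt_of_le_of_ne h0 (Ne.symm hx)), ENNReal.ofReal_zero]

/-- The generalized gamma density is midpoint log-convex on `(0, ∞)` if `γ ≤ 1` and `γ r ≤ 1`. -/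
theorem genGammaPDF_sq_le {r γ μ x h : ℝ} (hr : 0 < r) (hγ : 0 < γ) (hγ1 : γ ≤ 1)
    (hγr : γ * r ≤ 1) (hμ : 0 < μ) (hx : 0 < x) (hh : 0 ≤ h) :
    genGammaPDF r γ μ (x + h) ^ 2 ≤ genGammaPDF r γ μ x * genGammaPDF r γ μ (x + 2 * h) := by
  have hy : 0 < x + h := by positivity
  have hz : 0 < x + 2 * h := by positivity
  rw [genGammaPDF, genGammaPDF, genGammaPDF, if_pos hx.le, if_pos hy.le, if_pos hz.le]
  have hC : 0 < |γ| * μ ^ r / Real.Gamma r := by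
    have := Real.Gamma_pos_of_pos hr
    positivity
  generalize |γ| * μ ^ r / Real.Gamma r = C at hC
  -- (x + h)² ≥ x(x + 2h), and the exponent γr - 1 is nonpositive.
  have hpow : ((x + h) ^ (γ * r - 1)) ^ 2 ≤ x ^ (γ * r - 1) * (x + 2 * h) ^ (γ * r - 1) := by
    rw [sq, ← Real.mul_rpow hy.le hy.le, ← Real.mul_rpow hx.le hz.le]
    exact Real.rpow_le_rpow_of_nonpos (by positivity) (by nlinarith [sq_nonneg h]) (by linarith)
  have hexp : Real.exp (-(μ * (x + h) ^ γ)) ^ 2 ≤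
      Real.exp (-(μ * x ^ γ)) * Real.exp (-(μ * (x + 2 * h) ^ γ)) := by
    rw [sq, ← Real.exp_add, ← Real.exp_add, Real.exp_le_exp]
    -- Midpoint concavity of t ↦ t^γ, which is where γ ≤ 1 is needed.
    have hc := (Real.concaveOn_rpow hγ.le hγ1).2 (Set.mem_Ici.mpr hx.le)
      (Set.mem_Ici.mpr hz.le) (by norm_num : (0 : ℝ) ≤ 1 / 2) (by norm_num : (0 : ℝ) ≤ 1 / 2)
      (by norm_num)
    simp only [smul_eq_mul] at hc
    rw [show 1 / 2 * x + 1 / 2 * (x + 2 * h) = x + h by ring] at hc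
    nlinarith
  calc (C * (x + h) ^ (γ * r - 1) * Real.exp (-(μ * (x + h) ^ γ))) ^ 2
      = C ^ 2 * (((x + h) ^ (γ * r - 1)) ^ 2 * Real.exp (-(μ * (x + h) ^ γ)) ^ 2) := by ring
    _ ≤ C ^ 2 * ((x ^ (γ * r - 1) * (x + 2 * h) ^ (γ * r - 1)) *
        (Real.exp (-(μ * x ^ γ)) * Real.exp (-(μ * (x + 2 * h) ^ γ)))) := by gcongr
    _ = _ := by ring

/-- Translating every cell to [0, h) lets adjacent masses be compared pointwise under one integral.
-/
theorem genGammaMeasure_Ico (r γ μ a h : ℝ) :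
    genGammaMeasure r γ μ (Set.Ico a (a + h)) =
      ∫⁻ t in Set.Ico 0 h, ENNReal.ofReal (genGammaPDF r γ μ (a + t)) := by
  rw [genGammaMeasure, withDensity_apply _ measurableSet_Ico,
    ← (measurePreserving_add_left volume a).setLIntegral_comp_preimage measurableSet_Ico
      (measurable_genGammaPDF r γ μ).ennreal_ofReal]
  simp

theorem genGammaMeasure_Ico_sq_le {r γ μ a h : ℝ} (hr : 0 < r) (hγ : 0 < γ) (hγ1 : γ ≤ 1)
    (hγr : γ * r ≤ 1) (hμ : 0 < μ) (ha : 0 ≤ a) (hh : 0 ≤ h) :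
    genGammaMeasure r γ μ (Set.Ico (a + h) (a + 2 * h)) ^ 2 ≤
      genGammaMeasure r γ μ (Set.Ico a (a + h)) *
        genGammaMeasure r γ μ (Set.Ico (a + 2 * h) (a + 3 * h)) := by
  rw [show a + 3 * h = a + 2 * h + h by ring, genGammaMeasure_Ico r γ μ (a + 2 * h),
    show a + 2 * h = a + h + h by ring, genGammaMeasure_Ico, genGammaMeasure_Ico]
  have hm : ∀ b, Measurable fun t => ENNReal.ofReal (genGammaPDF r γ μ (b + t)) := fun b =>
    ((measurable_genGammaPDF r γ μ).comp (measurable_const_add b)).ennreal_ofReal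
  refine sq_lintegral_le_of_sq_le (hm _).aemeasurable (hm _).aemeasurable ?_
  -- The point t = 0 is discarded because a may be 0, where the density inequality is not available.
  filter_upwards [ae_restrict_mem measurableSet_Ico,
    ae_restrict_of_ae (Measure.ae_ne volume (0 : ℝ))] with t ht ht0
  have htpos : 0 < t := lt_of_le_of_ne ht.1 (Ne.symm ht0)
  have h0 := genGammaPDF_nonneg (μ := μ) hr hμ γ
  rw [← ENNReal.ofReal_pow (h0 _), ← ENNReal.ofReal_mul (h0 _)]
  refine ENNReal.ofReal_le_ofReal ?_
  have := genGammaPDF_sq_le (x := a + t) hr hγ hγ1 hγr hμ (by positivity) hh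
  convert! this using 3 <;> ring

theorem genGammaMeasure_Ico_pos {r γ μ a b : ℝ} (hr : 0 < r) (hγ : 0 < γ) (hμ : 0 < μ)
    (ha : 0 ≤ a) (hab : a < b) : 0 < genGammaMeasure r γ μ (Set.Ico a b) := by
  refine lt_of_lt_of_le ?_ (measure_mono Set.Ioo_subset_Ico_self)
  rw [genGammaMeasure, withDensity_apply _ measurableSet_Ioo,
    setLIntegral_pos_iff (measurable_genGammaPDF r γ μ).ennreal_ofReal]
  rw [Set.inter_eq_right.mpr, Real.volume_Ioo]
  · simpa using hab
  · intro x hx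
    exact (ENNReal.ofReal_pos.mpr (genGammaPDF_pos hr hγ hμ (ha.trans_lt hx.1))).ne'

/-! ### Ratios with a positive denominator -/

section Ratio

variable {G W : Measure ℝ} [IsProbabilityMeasure G] [IsProbabilityMeasure W]

theorem measurable_ratio : Measurable fun p : ℝ × ℝ => p.1 / p.2 := by fun_prop

theorem map_div_prod_apply {s : Set ℝ} (hs : MeasurableSet s) :
    (G.prod W).map (fun p => p.1 / p.2) s = ∫⁻ w, G {x | x / w ∈ s} ∂W := by
  rw [Measure.map_apply measurable_ratio hs, Measure.prod_apply_symm (measurable_ratio hs)]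
  rfl

theorem measurable_measure_div_mem {s : Set ℝ} (hs : MeasurableSet s) :
    Measurable fun w => G {x | x / w ∈ s} :=
  measurable_measure_prodMk_right (measurable_ratio hs)

theorem setOf_div_mem_Ico {w : ℝ} (hw : 0 < w) (a b : ℝ) :
    {x | x / w ∈ Set.Ico a b} = Set.Ico (a * w) (b * w) := by
  ext x
  simp only [Set.mem_ofPred_eq, Set.mem_Ico, le_div_iff₀ hw, div_lt_iff₀ hw]

/-- Log-convexity of cell masses is inherited by the law of a ratio with positive denominator. -/
theorem map_div_prod_Ico_sq_le (hW : ∀ᵐ w ∂W, 0 < w)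
    (hG : ∀ a h : ℝ, 0 ≤ a → 0 ≤ h → G (Set.Ico (a + h) (a + 2 * h)) ^ 2 ≤
      G (Set.Ico a (a + h)) * G (Set.Ico (a + 2 * h) (a + 3 * h)))
    {h : ℝ} (hh : 0 ≤ h) (k : ℕ) :
    (G.prod W).map (fun p => p.1 / p.2) (Set.Ico (h * (k + 1)) (h * (k + 2))) ^ 2 ≤
      (G.prod W).map (fun p => p.1 / p.2) (Set.Ico (h * k) (h * (k + 1))) *
        (G.prod W).map (fun p => p.1 / p.2) (Set.Ico (h * (k + 2)) (h * (k + 3))) := by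
  simp only [map_div_prod_apply measurableSet_Ico]
  refine sq_lintegral_le_of_sq_le (measurable_measure_div_mem measurableSet_Ico).aemeasurable
    (measurable_measure_div_mem measurableSet_Ico).aemeasurable ?_
  filter_upwards [hW] with w hw
  simp only [setOf_div_mem_Ico hw]
  -- Conditionally on w, the cells have mesh hw and start at hkw.
  convert! hG (h * k * w) (h * w) (by positivity) (by positivity) using 4 <;> ring_nf

theorem map_div_prod_Ico_pos (hW : ∀ᵐ w ∂W, 0 < w)
    (hG : ∀ a b : ℝ, 0 ≤ a → a < b → 0 < G (Set.Ico a b)) {a b : ℝ} (ha : 0 ≤ a) (hab : a < b) :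
    0 < (G.prod W).map (fun p => p.1 / p.2) (Set.Ico a b) := by
  rw [map_div_prod_apply measurableSet_Ico, pos_iff_ne_zero, Ne,
    lintegral_eq_zero_iff (measurable_measure_div_mem measurableSet_Ico)]
  intro h0
  obtain ⟨w, hw, hw0⟩ := (hW.and h0).exists
  simp only [setOf_div_mem_Ico hw, Pi.zero_apply] at hw0
  exact (hG _ _ (by positivity) (mul_lt_mul_of_pos_right hab hw)).ne' hw0

end Ratio

theorem ae_nonneg_map_div_prod {G W : Measure ℝ} [SFinite W] (hG : ∀ᵐ x ∂G, 0 < x)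
    (hW : ∀ᵐ w ∂W, 0 < w) :
    ∀ᵐ x ∂(G.prod W).map (fun p => p.1 / p.2), 0 ≤ x := by
  rw [ae_map_iff measurable_ratio.aemeasurable measurableSet_Ici]
  filter_upwards [Measure.quasiMeasurePreserving_fst.ae hG,
    Measure.quasiMeasurePreserving_snd.ae hW] with p h1 h2
  exact (div_pos h1 h2).le

/-! ### Infinite divisibility -/

theorem theorem4 (r α γ lam : ℝ) (hr : r ∈ Set.Ioc (0 : ℝ) 1) (hα : 0 < α) (hγ : 0 < γ)
    (hαγ : α * γ ∈ Set.Ioc (0 : ℝ) 1) (hlam : 0 < lam) :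
    IsInfinitelyDivisibleDF (limitDF r α γ lam) := by
  intro n hn
  -- The bound r ≤ 1 enters only here, to make the power factor of the density log-convex.
  have hrγ : α * γ * r ≤ 1 := mul_le_one₀ hαγ.2 hr.1.le hr.2
  have := isProbabilityMeasure_genGammaMeasure hr.1 hαγ.1 hlam
  have : IsProbabilityMeasure (weibullMeasure α) :=
    isProbabilityMeasure_genGammaMeasure one_pos hα one_pos
  have hW : ∀ᵐ w ∂weibullMeasure α, 0 < w := ae_pos_genGammaMeasure 1 α 1
  have hprob : IsProbabilityMeasure (ratioLaw r α γ lam) :=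
    Measure.isProbabilityMeasure_map measurable_ratio.aemeasurable
  obtain ⟨ν, hν, hroot⟩ := exists_root_of_logConvex_cells (μ := ratioLaw r α γ lam)
    (ae_nonneg_map_div_prod (ae_pos_genGammaMeasure r (α * γ) lam) hW)
    (fun h hh k => map_div_prod_Ico_pos hW
      (fun a b ha hab => genGammaMeasure_Ico_pos hr.1 hαγ.1 hlam ha hab) (by positivity)
      (by gcongr; linarith))
    (fun h hh k => map_div_prod_Ico_sq_le hW
      (fun a h ha hh => genGammaMeasure_Ico_sq_le hr.1 hαγ.1 hαγ.2 hrγ hlam ha hh) hh.le k) hn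
  refine ⟨ν, hν, ?_⟩
  rw [hroot]
  rfl
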